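/- Let $k$ be a number field, $v$ a non-trivial non-Archimedean place of $k$, $k_v$ the completion of $k$ at $v$, $\bar k_v$ an algebraic closure of $k_v$, and $|\cdot|_v$ the unique extension to $\bar k_v$ of the $v$-adic absolute value of $k_v$. Let $\gamma\in\bar k_v$, let $k'\subseteq k_v(\gamma)$ be any subfield, and let $K$ be any field extension of $k'$. Let $\lambda_1,\dots,\lambda_m\in K[X]\setminus\{0\}$, let $\alpha_1,\dots,\alpha_m\in K\setminus\{0\}$ be distinct, and for $n\in\mathbb Z$ put $$S_n=\sum_{i=1}^m\lambda_i(n)\,\alpha_i^n .$$ Assume that there is an integer $n_0$ such that $S_n\in k'$ for every $n\ge n_0$. Then $S_n\in k'$ for every $n\in\mathbb Z$, and: (i) There is a nonzero polynomial $f\in k'[X]$ which splits into linear factors over $K$ and whose set of roots is $\{\alpha_1,\dots,\alpha_m\}$; in particular the $\alpha_i$ are algebraic over $k'$, and $k'(\alpha_1,\dots,\alpha_m)$ admits a $k'$-embedding into $\bar k_v$. Moreover, if $|S_n|_v=O(1)$ as $n\to+\infty$, then $|\alpha_i|_v\le 1$ for every $i$, where $|\alpha_i|_v$ may be computed through any $k'$-embedding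 $k'(\alpha_1,\dots,\alpha_m)\to\bar k_v$. (ii) For every $i$, $k'(\lambda_i)\subseteq k'(\alpha_i)$, where $k'(\lambda_i)\subseteq K$ is the field generated over $k'$ by the coefficients of $\lambda_i$. (iii) Every $\lambda_i$ has its coefficients in $k'(\alpha_1,\dots,\alpha_m)$, and for every $k'$-automorphism $\sigma$ of $k'(\alpha_1,\dots,\alpha_m)$ and every permutation $\pi$ of $\{1,\dots,m\}$ such that $\sigma(\alpha_i)=\alpha_{\pi(i)}$ for all $i$, one has $\sigma(\lambda_i)=\lambda_{\pi(i)}$ for all $i$, where $\sigma$ acts on polynomials coefficientwise. (iv) If $\lambda_1,\dots,\lambda_m$ are distinct polynomials, then $k'(\alpha_i)=k'(\lambda_i)$ for every $i$. -/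

import Mathlib

open Polynomial Filter Asymptotics
open scoped NumberField IntermediateField

/-- The combination of powers `S_n = ∑ i, λ_i(n) * α_i ^ n`, for `n : ℤ`. -/
noncomputable def powerSum {K : Type*} [Field K] {m : ℕ} (lam : Fin m → K[X]) (α : Fin m → K)
    (n : ℤ) : K :=
  ∑ i, (lam i).eval (n : K) * α i ^ n

/-- `F(p)`: the subfield of `K` generated over `F` by the coefficients of `p`. -/
noncomputable def coeffField (F : Type*) {K : Type*} [Field F] [Field K] [Algebra F K] (p : K[X]) :
    IntermediateField F K :=
  IntermediateField.adjoin F (Set.range p.coeff)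

/-- `F(α_1, …, α_m)`. -/
noncomputable abbrev rootsField (F : Type*) {K : Type*} [Field F] [Field K] [Algebra F K] {m : ℕ}
    (α : Fin m → K) : IntermediateField F K :=
  IntermediateField.adjoin F (Set.range α)

/-- `α_i` regarded as an element of `F(α_1, …, α_m)`. -/
noncomputable def rootIn (F : Type*) {K : Type*} [Field F] [Field K] [Algebra F K] {m : ℕ}
    (α : Fin m → K) (i : Fin m) : rootsField F α :=
  ⟨α i, IntermediateField.subset_adjoin F _ (Set.mem_range_self i)⟩

/-- The absolute value `|x|_v` on an algebraic closure `C` of the completion `k_v`: the unique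
extension (the spectral norm) of the `v`-adic absolute value of `k_v`. -/
noncomputable def absV {k : Type*} [Field k] [NumberField k]
    (v : IsDedekindDomain.HeightOneSpectrum (𝓞 k))
    {C : Type*} [Field C] [Algebra (v.adicCompletion k) C] (x : C) : ℝ :=
  spectralNorm (v.adicCompletion k) C x

/-!
Let `E` be the shift on two-sided sequences. On `n ↦ λ(n) * a ^ n` it acts through the polynomial
factor, as `λ ↦ a • λ(X + 1)`; a polynomial `p(E)` is therefore triangular for the degree of `λ`,
with diagonal entries `p(a)`, while `E - a` lowers the degree. Hence some `p(E)` reduces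
`S_n = ∑ i, λ_i(n) * α_i ^ n` to a nonzero multiple of a single `α_i ^ n`
(`exists_aeval_seqShift_powerSum_eq_zpow`). This gives two things: the `λ_i` are determined by the
values of `S` on any half-line (`eq_of_powerSum_eq`), and if `S_n` is bounded as `n → ∞` then so is
`α_i ^ n`, whence `|α_i| ≤ 1` (`ringNorm_le_one_of_powerSum_isBigO`).

Let `F` be the ground field, with `S_n ∈ F` for large `n`. Applying an `F`-linear functional
`K → F` to the coefficients of a relation `p(E) S = 0` gives a relation over `F`. As functionals
separate points, the generator `f` of the relations over `F` divides all relations over `K`, in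
particular `∏ i, (X - α_i) ^ (deg λ_i + 1)`; so `f` splits over `K`, with roots exactly the `α_i`
(`exists_annihilator_splits`). Its constant term is nonzero, and running the recurrence backwards
gives `S_n ∈ F` for all `n` (`powerSum_mem_range`).

Consequently `L = F(α_1, …, α_m)` is a finite Galois extension of `F`. An `L`-linear retraction
`K → L` shows that the `λ_i` have coefficients in `L`. An automorphism `σ` of `L` over `F` fixes
every `S_n` and permutes the `α_i`, so by independence it permutes the `λ_i` in the same way
(`map_eq_of_forall_apply_eq`). Thus `σ` fixes `λ_i` when it fixes `α_i`, and conversely when the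
`λ_i` are distinct; the Galois correspondence turns this into the inclusions between `F(α_i)` and
`F(λ_i)`.
-/

/-! ### The shift operator on sequences of the form `n ↦ ∑ i, λ_i(n) * α_i ^ n` -/

/-- The shift `s ↦ (n ↦ s (n + 1))` on two-sided sequences. -/
def seqShift (K : Type*) [Field K] : Module.End K (ℤ → K) :=
  LinearMap.funLeft K K (· + 1)

/-- The action of the shift on the polynomial factor of `n ↦ λ(n) * a ^ n`: it sends `λ` to
`a • λ(X + 1)`. -/
noncomputable def twistedShift {K : Type*} [Field K] (a : K) : Module.End K K[X] :=
  a • taylor 1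

section Shift

variable {K : Type*} [Field K] {m : ℕ}

lemma seqShift_pow_apply (j : ℕ) (s : ℤ → K) (n : ℤ) : (seqShift K ^ j) s n = s (n + j) := by
  induction j generalizing n with
  | zero => simp
  | succ j ih =>
    rw [pow_succ', Module.End.mul_apply]
    change (seqShift K ^ j) s (n + 1) = _
    rw [ih]
    congr 1
    push_cast
    ring

lemma aeval_seqShift_apply (p : K[X]) (s : ℤ → K) (n : ℤ) :
    aeval (seqShift K) p s n = p.sum fun j c => c * s (n + j) := by
  simp [aeval_eq_sum_range, Polynomial.sum_over_range, LinearMap.sum_apply, Finset.sum_apply,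
    seqShift_pow_apply]

lemma aeval_seqShift_apply_of_le {p : K[X]} {d : ℕ} (hd : p.natDegree < d) (s : ℤ → K) (n : ℤ) :
    aeval (seqShift K) p s n = ∑ j ∈ Finset.range d, p.coeff j * s (n + j) := by
  rw [aeval_seqShift_apply, Polynomial.sum_over_range' _ (by simp) _ hd]

lemma powerSum_add (lam mu : Fin m → K[X]) (α : Fin m → K) :
    powerSum (lam + mu) α = powerSum lam α + powerSum mu α := by
  funext n
  simp [powerSum, add_mul, Finset.sum_add_distrib]

lemma powerSum_sub (lam mu : Fin m → K[X]) (α : Fin m → K) :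
    powerSum (lam - mu) α = powerSum lam α - powerSum mu α := by
  funext n
  simp [powerSum, sub_mul, Finset.sum_sub_distrib]

lemma powerSum_smul (c : K) (lam : Fin m → K[X]) (α : Fin m → K) :
    powerSum (c • lam) α = c • powerSum lam α := by
  funext n
  simp [powerSum, Finset.mul_sum, mul_assoc]

lemma powerSum_zero (α : Fin m → K) : powerSum 0 α = 0 := by
  funext n
  simp [powerSum]

lemma map_powerSum {L : Type*} [Field L] (g : K →+* L) (lam : Fin m → K[X]) (α : Fin m → K)
    (n : ℤ) : g (powerSum lam α n) = powerSum (fun i => (lam i).map g) (fun i => g (α i)) n := by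
  simp only [powerSum, map_sum, map_mul, map_zpow₀]
  refine Finset.sum_congr rfl fun i _ => ?_
  rw [← map_intCast g n, eval_map_apply]

lemma seqShift_powerSum (lam : Fin m → K[X]) {α : Fin m → K} (hα : ∀ i, α i ≠ 0) :
    seqShift K (powerSum lam α) = powerSum (fun i => twistedShift (α i) (lam i)) α := by
  funext n
  change powerSum lam α (n + 1) = _
  refine Finset.sum_congr rfl fun i _ => ?_
  rw [zpow_add_one₀ (hα i)]
  simp only [twistedShift, LinearMap.smul_apply, eval_smul, taylor_eval, smul_eq_mul,
    Int.cast_add, Int.cast_one]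
  ring

/-- A polynomial in the shift acts on the summands `λ_i(n) * α_i ^ n` separately. -/
lemma aeval_seqShift_powerSum (p : K[X]) (lam : Fin m → K[X]) {α : Fin m → K}
    (hα : ∀ i, α i ≠ 0) :
    aeval (seqShift K) p (powerSum lam α) =
      powerSum (fun i => aeval (twistedShift (α i)) p (lam i)) α := by
  have hpow : ∀ j : ℕ, (seqShift K ^ j) (powerSum lam α) =
      powerSum (fun i => (twistedShift (α i) ^ j) (lam i)) α := by
    intro j
    induction j with
    | zero => simp
    | succ j ih => simp only [pow_succ', Module.End.mul_apply, ih, seqShift_powerSum _ hα]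
  induction p using Polynomial.induction_on' with
  | add p q hp hq =>
    simp only [map_add, LinearMap.add_apply, hp, hq]
    exact (powerSum_add _ _ _).symm
  | monomial j c =>
    simp only [aeval_monomial, Module.End.mul_apply, Module.algebraMap_end_apply, hpow]
    exact (powerSum_smul _ _ _).symm

/-- A polynomial `p` in the twisted shift is triangular for the degree, with diagonal entries
`p(a)`. -/
lemma aeval_twistedShift_natDegree_le (a : K) (p : K[X]) {q : K[X]} {d : ℕ}
    (hq : q.natDegree ≤ d) :
    (aeval (twistedShift a) p q).natDegree ≤ d ∧
      (aeval (twistedShift a) p q).coeff d = p.eval a * q.coeff d := by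
  have hpow : ∀ j : ℕ, ((twistedShift a ^ j) q).natDegree ≤ d ∧
      ((twistedShift a ^ j) q).coeff d = a ^ j * q.coeff d := by
    intro j
    induction j with
    | zero => simpa using hq
    | succ j ih =>
      set r := (twistedShift a ^ j) q with hr
      have htaylor : (taylor 1 r).coeff d = r.coeff d := by
        rcases ih.1.lt_or_eq with h | h
        · rw [coeff_eq_zero_of_natDegree_lt h,
            coeff_eq_zero_of_natDegree_lt (by rwa [natDegree_taylor])]
        · rw [← h, coeff_taylor_natDegree, leadingCoeff]
      rw [pow_succ', Module.End.mul_apply, ← hr]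
      simp only [twistedShift, LinearMap.smul_apply]
      refine ⟨(natDegree_smul_le _ _).trans (by rw [natDegree_taylor]; exact ih.1), ?_⟩
      rw [coeff_smul, htaylor, ih.2, smul_eq_mul, pow_succ', mul_assoc]
  induction p using Polynomial.induction_on' with
  | add p₁ p₂ h₁ h₂ =>
    simp only [map_add, LinearMap.add_apply, coeff_add, h₁.2, h₂.2, eval_add, add_mul, and_true]
    exact natDegree_add_le_of_degree_le h₁.1 h₂.1
  | monomial j c =>
    simp only [aeval_monomial, Module.End.mul_apply, Module.algebraMap_end_apply, coeff_smul,
      (hpow j).2, eval_monomial, smul_eq_mul, mul_assoc, and_true]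
    exact (natDegree_smul_le _ _).trans (hpow j).1

lemma aeval_twistedShift_ne_zero {a : K} {p q : K[X]} (hp : p.eval a ≠ 0) (hq : q ≠ 0) :
    aeval (twistedShift a) p q ≠ 0 := by
  intro h
  have := (aeval_twistedShift_natDegree_le a p (le_refl q.natDegree)).2
  rw [h, coeff_zero, coeff_natDegree] at this
  exact mul_ne_zero hp (leadingCoeff_ne_zero.2 hq) this.symm

lemma aeval_twistedShift_X_sub_C_C (a c : K) :
    aeval (twistedShift a) (X - C a) (C c) = 0 := by
  simp [twistedShift, Module.algebraMap_end_apply, smul_C]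

lemma natDegree_aeval_twistedShift_X_sub_C (a : K) {q : K[X]} {d : ℕ}
    (hq : q.natDegree ≤ d + 1) : (aeval (twistedShift a) (X - C a) q).natDegree ≤ d := by
  obtain ⟨h₁, h₂⟩ := aeval_twistedShift_natDegree_le a (X - C a) hq
  rw [natDegree_le_iff_coeff_eq_zero]
  intro N hN
  rcases (Nat.succ_le_of_lt hN).lt_or_eq with h | h
  · exact coeff_eq_zero_of_natDegree_lt (h₁.trans_lt h)
  · rw [← h, Nat.succ_eq_add_one, h₂]
    simp

lemma aeval_twistedShift_X_sub_C_pow_eq_zero (a : K) {q : K[X]} {d : ℕ} (hq : q.natDegree ≤ d) :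
    aeval (twistedShift a) ((X - C a) ^ (d + 1)) q = 0 := by
  induction d generalizing q with
  | zero =>
    rw [eq_C_of_natDegree_le_zero hq, zero_add, pow_one, aeval_twistedShift_X_sub_C_C]
  | succ d ih =>
    rw [pow_succ, map_mul, Module.End.mul_apply]
    exact ih (natDegree_aeval_twistedShift_X_sub_C a hq)

/-- In characteristic zero only the constants are fixed by `q ↦ q(X + 1)`, so that the powers of
`X - a` lead from a nonzero polynomial to a nonzero constant. -/
lemma exists_aeval_twistedShift_X_sub_C_pow_eq_C [CharZero K] {a : K} (ha : a ≠ 0) {q : K[X]}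
    (hq : q ≠ 0) :
    ∃ (j : ℕ) (c : K), c ≠ 0 ∧ aeval (twistedShift a) ((X - C a) ^ j) q = C c := by
  have key : ∀ (d : ℕ) (q : K[X]), q ≠ 0 → q.natDegree ≤ d →
      ∃ (j : ℕ) (c : K), c ≠ 0 ∧ aeval (twistedShift a) ((X - C a) ^ j) q = C c := by
    intro d
    induction d with
    | zero =>
      intro q hq hd
      rw [eq_C_of_natDegree_le_zero hd] at hq ⊢
      exact ⟨0, _, by simpa using hq, by simp⟩
    | succ d ih =>
      intro q hq hd
      by_cases h : aeval (twistedShift a) (X - C a) q = 0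
      · have hfix : taylor 1 q = q := by
          simp only [twistedShift, map_sub, aeval_X, aeval_C, LinearMap.sub_apply,
            LinearMap.smul_apply, Module.algebraMap_end_apply, ← smul_sub] at h
          exact sub_eq_zero.1 ((smul_eq_zero.1 h).resolve_left ha)
        have hval : ∀ n : ℕ, q.eval (n : K) = q.eval 0 := by
          intro n
          induction n with
          | zero => simp
          | succ n ihn => rw [Nat.cast_succ, ← taylor_eval, hfix, ihn]
        have hconst : q = C (q.eval 0) := by
          refine eq_of_infinite_eval_eq _ _ ((Set.infinite_range_of_injective
            (Nat.cast_injective (R := K))).mono ?_)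
          rintro _ ⟨n, rfl⟩
          simpa using hval n
        refine ⟨0, q.eval 0, fun h0 => hq ?_, by simpa using hconst⟩
        rw [hconst, h0, C_0]
      · obtain ⟨j, c, hc, hj⟩ := ih _ h (natDegree_aeval_twistedShift_X_sub_C a hd)
        exact ⟨j + 1, c, hc, by rw [pow_succ, map_mul, Module.End.mul_apply, hj]⟩
  exact key _ q hq le_rfl

/-- The product of the `(X - α_i) ^ (deg λ_i + 1)`: the polynomial in the shift that annihilates
`n ↦ ∑ i, λ_i(n) * α_i ^ n`. -/
noncomputable def annihilatingPoly (lam : Fin m → K[X]) (α : Fin m → K) : K[X] :=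
  ∏ i, (X - C (α i)) ^ ((lam i).natDegree + 1)

end Shift

/-! ### Independence of the summands over a half-line -/

section Independence

variable {K : Type*} [Field K] {m : ℕ}

lemma aeval_annihilatingPoly_powerSum (lam : Fin m → K[X]) {α : Fin m → K}
    (hα : ∀ i, α i ≠ 0) :
    aeval (seqShift K) (annihilatingPoly lam α) (powerSum lam α) = 0 := by
  rw [aeval_seqShift_powerSum _ _ hα, ← powerSum_zero α]
  congr 1
  funext i
  rw [annihilatingPoly, ← Finset.prod_erase_mul _ _ (Finset.mem_univ i), map_mul,
    Module.End.mul_apply, aeval_twistedShift_X_sub_C_pow_eq_zero _ le_rfl, map_zero,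
    Pi.zero_apply]

lemma annihilatingPoly_monic (lam : Fin m → K[X]) (α : Fin m → K) :
    (annihilatingPoly lam α).Monic :=
  monic_prod_of_monic _ _ fun _ _ => (monic_X_sub_C _).pow _

lemma annihilatingPoly_splits (lam : Fin m → K[X]) (α : Fin m → K) :
    (annihilatingPoly lam α).Splits :=
  Splits.prod fun _ _ => (Splits.X_sub_C _).pow _

lemma mem_range_of_eval_annihilatingPoly_eq_zero (lam : Fin m → K[X]) (α : Fin m → K) {x : K}
    (hx : (annihilatingPoly lam α).eval x = 0) : x ∈ Set.range α := by
  rw [annihilatingPoly, eval_prod, Finset.prod_eq_zero_iff] at hx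
  obtain ⟨i, -, hi⟩ := hx
  refine ⟨i, ?_⟩
  have := eq_zero_of_pow_eq_zero ((eval_pow _).symm.trans hi)
  rw [eval_sub, eval_X, eval_C, sub_eq_zero] at this
  exact this.symm

/-- A suitable polynomial in the shift isolates a single geometric sequence: it kills the summands
with index `j ≠ i` and differentiates `λ_i` down to a nonzero constant. -/
lemma exists_aeval_seqShift_powerSum_eq_zpow [CharZero K] {lam : Fin m → K[X]} {α : Fin m → K}
    (hα : ∀ i, α i ≠ 0) (hα_inj : Function.Injective α) {i : Fin m} (hi : lam i ≠ 0) :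
    ∃ (p : K[X]) (c : K), c ≠ 0 ∧
      aeval (seqShift K) p (powerSum lam α) = fun n => c * α i ^ n := by
  set P : K[X] := ∏ j ∈ Finset.univ.erase i, (X - C (α j)) ^ ((lam j).natDegree + 1) with hP
  have hPi : aeval (twistedShift (α i)) P (lam i) ≠ 0 := by
    refine aeval_twistedShift_ne_zero ?_ hi
    rw [hP, eval_prod, Finset.prod_ne_zero_iff]
    intro j hj
    rw [eval_pow, eval_sub, eval_X, eval_C]
    exact pow_ne_zero _ (sub_ne_zero.2 (hα_inj.ne (Finset.ne_of_mem_erase hj).symm))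
  obtain ⟨d, c, hc, hd⟩ := exists_aeval_twistedShift_X_sub_C_pow_eq_C (hα i) hPi
  refine ⟨(X - C (α i)) ^ d * P, c, hc, ?_⟩
  rw [aeval_seqShift_powerSum _ _ hα]
  funext n
  rw [powerSum, Finset.sum_eq_single i]
  · rw [map_mul, Module.End.mul_apply, hd, eval_C]
  · intro j _ hj
    rw [hP, ← Finset.prod_erase_mul _ _ (Finset.mem_erase.2 ⟨hj, Finset.mem_univ j⟩), ← mul_assoc,
      map_mul, Module.End.mul_apply, aeval_twistedShift_X_sub_C_pow_eq_zero _ le_rfl, map_zero,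
      eval_zero, zero_mul]
  · simp

lemma aeval_seqShift_eq_zero_of_le {s : ℤ → K} {n₀ : ℤ} (hs : ∀ n, n₀ ≤ n → s n = 0) (p : K[X])
    {n : ℤ} (hn : n₀ ≤ n) : aeval (seqShift K) p s n = 0 := by
  rw [aeval_seqShift_apply, Polynomial.sum_def]
  exact Finset.sum_eq_zero fun j _ => by rw [hs _ (by omega), mul_zero]

/-- Independence: already the values on a half-line determine the polynomial factors. -/
lemma eq_zero_of_powerSum_eq_zero [CharZero K] {lam : Fin m → K[X]} {α : Fin m → K}
    (hα : ∀ i, α i ≠ 0) (hα_inj : Function.Injective α) {n₀ : ℤ}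
    (h : ∀ n, n₀ ≤ n → powerSum lam α n = 0) : lam = 0 := by
  funext i
  by_contra hi
  obtain ⟨p, c, hc, hp⟩ := exists_aeval_seqShift_powerSum_eq_zpow hα hα_inj hi
  have h0 := aeval_seqShift_eq_zero_of_le h p le_rfl
  rw [hp] at h0
  exact mul_ne_zero hc (zpow_ne_zero _ (hα i)) h0

lemma eq_of_powerSum_eq [CharZero K] {lam mu : Fin m → K[X]} {α : Fin m → K}
    (hα : ∀ i, α i ≠ 0) (hα_inj : Function.Injective α) {n₀ : ℤ}
    (h : ∀ n, n₀ ≤ n → powerSum lam α n = powerSum mu α n) : lam = mu := by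
  refine sub_eq_zero.1 (eq_zero_of_powerSum_eq_zero hα hα_inj (n₀ := n₀) fun n hn => ?_)
  rw [powerSum_sub, Pi.sub_apply, h n hn, sub_self]

end Independence

/-! ### Descent of the annihilator and of the coefficients by linear functionals -/

section Descent

/-- The polynomial obtained by applying a linear map to each coefficient. -/
noncomputable def mapCoeff {F K : Type*} [Field F] [Field K] [Algebra F K] (l : K →ₗ[F] F)
    (p : K[X]) : F[X] :=
  ∑ j ∈ Finset.range (p.natDegree + 1), monomial j (l (p.coeff j))

variable {F K : Type*} [Field F] [Field K] [Algebra F K] {m : ℕ}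

lemma coeff_mapCoeff (l : K →ₗ[F] F) (p : K[X]) (j : ℕ) :
    (mapCoeff l p).coeff j = l (p.coeff j) := by
  simp only [mapCoeff, finsetSum_coeff, coeff_monomial]
  rw [Finset.sum_ite_eq' (Finset.range _)]
  split_ifs with h
  · rfl
  · rw [coeff_eq_zero_of_natDegree_lt (by simpa using h), map_zero]

lemma natDegree_mapCoeff_le (l : K →ₗ[F] F) (p : K[X]) :
    (mapCoeff l p).natDegree ≤ p.natDegree :=
  natDegree_le_iff_coeff_eq_zero.2 fun j hj => by
    rw [coeff_mapCoeff, coeff_eq_zero_of_natDegree_lt hj, map_zero]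

lemma eval_mapCoeff (l : K →ₗ[F] F) (p : K[X]) (x : F) :
    (mapCoeff l p).eval x = l (p.eval (algebraMap F K x)) := by
  rw [eval_eq_sum_range' (Nat.lt_succ_of_le (natDegree_mapCoeff_le l p)),
    eval_eq_sum_range, map_sum]
  refine Finset.sum_congr rfl fun j _ => ?_
  rw [coeff_mapCoeff, ← map_pow, mul_comm (p.coeff j), ← Algebra.smul_def, map_smul, smul_eq_mul,
    mul_comm]

lemma charZero_of_algebra [CharZero F] : CharZero K :=
  charZero_of_injective_algebraMap (algebraMap F K).injective

/-- The ideal of the polynomials over `F` that annihilate a sequence with values in `K` when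
evaluated at the shift. -/
noncomputable def annihilatorIdeal (F : Type*) {K : Type*} [Field F] [Field K] [Algebra F K]
    (s : ℤ → K) : Ideal F[X] where
  carrier := {p | aeval (seqShift K) (p.map (algebraMap F K)) s = 0}
  zero_mem' := by simp
  add_mem' := fun {p q} hp hq => by
    simp only [Set.mem_ofPred_eq] at hp hq ⊢
    rw [Polynomial.map_add, map_add, LinearMap.add_apply, hp, hq, add_zero]
  smul_mem' := fun p q hq => by
    simp only [Set.mem_ofPred_eq] at hq ⊢
    rw [smul_eq_mul, Polynomial.map_mul, map_mul, Module.End.mul_apply, hq, map_zero]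

lemma mem_annihilatorIdeal {s : ℤ → K} {p : F[X]} :
    p ∈ annihilatorIdeal F s ↔ aeval (seqShift K) (p.map (algebraMap F K)) s = 0 := Iff.rfl

/-- If the sequence is eventually `F`-valued, an `F`-linear functional applied coefficientwise
turns a relation over `K` into a relation over `F`. -/
lemma mapCoeff_mem_annihilatorIdeal [CharZero F] {lam : Fin m → K[X]} {α : Fin m → K}
    (hα : ∀ i, α i ≠ 0) (hα_inj : Function.Injective α) {n₀ : ℤ}
    (hS : ∀ n : ℤ, n₀ ≤ n → powerSum lam α n ∈ Set.range (algebraMap F K)) {q : K[X]}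
    (hq : aeval (seqShift K) q (powerSum lam α) = 0) (l : K →ₗ[F] F) :
    mapCoeff l q ∈ annihilatorIdeal F (powerSum lam α) := by
  have : CharZero K := charZero_of_algebra (F := F)
  rw [mem_annihilatorIdeal, aeval_seqShift_powerSum _ _ hα]
  set g := (mapCoeff l q).map (algebraMap F K) with hg
  rw [eq_zero_of_powerSum_eq_zero hα hα_inj (n₀ := n₀)
    (lam := fun i => aeval (twistedShift (α i)) g (lam i)), powerSum_zero]
  intro n hn
  choose s hs using hS
  rw [← aeval_seqShift_powerSum _ _ hα, aeval_seqShift_apply_of_le (d := q.natDegree + 1)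
    (by rw [hg, natDegree_map]; exact Nat.lt_succ_of_le (natDegree_mapCoeff_le l q))]
  have h0 := congrFun hq n
  rw [aeval_seqShift_apply_of_le (Nat.lt_succ_self _), Pi.zero_apply] at h0
  rw [← map_zero (algebraMap F K), ← map_zero l, ← h0, map_sum, map_sum]
  refine Finset.sum_congr rfl fun j _ => ?_
  rw [hg, coeff_map, coeff_mapCoeff, ← hs (n + j) (by omega), ← map_mul, mul_comm (q.coeff j),
    ← Algebra.smul_def, map_smul, smul_eq_mul, mul_comm]

/-- A generator over `F` of the annihilator of an eventually `F`-valued sequence also generates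
the relations over `K`, so it splits over `K`, with roots the `α_i`. -/
lemma exists_annihilator_splits [CharZero F] {lam : Fin m → K[X]} (hlam : ∀ i, lam i ≠ 0)
    {α : Fin m → K} (hα : ∀ i, α i ≠ 0) (hα_inj : Function.Injective α) {n₀ : ℤ}
    (hS : ∀ n : ℤ, n₀ ≤ n → powerSum lam α n ∈ Set.range (algebraMap F K)) :
    ∃ f : F[X], f ≠ 0 ∧ (f.map (algebraMap F K)).Splits ∧ f.rootSet K = Set.range α ∧
      f ∈ annihilatorIdeal F (powerSum lam α) := by
  have : CharZero K := charZero_of_algebra (F := F)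
  set I := annihilatorIdeal F (powerSum lam α) with hI
  set q := annihilatingPoly lam α with hq
  have hqS : aeval (seqShift K) q (powerSum lam α) = 0 := aeval_annihilatingPoly_powerSum lam hα
  set f := Submodule.IsPrincipal.generator I
  have hfI : f ∈ I := Submodule.IsPrincipal.generator_mem I
  have hf0 : f ≠ 0 := by
    obtain ⟨l, hl⟩ := not_forall.1
      (mt (Module.forall_dual_apply_eq_zero_iff F (1 : K)).1 one_ne_zero)
    have hmem : mapCoeff l q ∈ I := mapCoeff_mem_annihilatorIdeal hα hα_inj hS hqS l
    intro h0
    rw [Submodule.IsPrincipal.mem_iff_generator_dvd] at hmem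
    have hzero : mapCoeff l q = 0 := zero_dvd_iff.1 (h0 ▸ hmem)
    apply hl
    have := coeff_mapCoeff l q q.natDegree
    rwa [hzero, coeff_zero, coeff_natDegree, (annihilatingPoly_monic lam α).leadingCoeff,
      eq_comm] at this
  set g := f.map (algebraMap F K) with hg
  have hg0 : g ≠ 0 := (Polynomial.map_ne_zero_iff (algebraMap F K).injective).2 hf0
  -- The remainder of `q` modulo `f` is killed by every functional, for reasons of degree.
  have hdvd : g ∣ q := by
    rw [← EuclideanDomain.mod_eq_zero]
    have hdeg : (q % g).degree < g.degree := EuclideanDomain.mod_lt q hg0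
    have hr : aeval (seqShift K) (q % g) (powerSum lam α) = 0 := by
      rw [EuclideanDomain.mod_eq_sub_mul_div, map_sub, LinearMap.sub_apply, hqS, mul_comm g,
        map_mul, Module.End.mul_apply, mem_annihilatorIdeal.1 hfI, map_zero, sub_zero]
    ext j
    rw [coeff_zero, ← Module.forall_dual_apply_eq_zero_iff F]
    intro l
    have hmem : mapCoeff l (q % g) ∈ I := mapCoeff_mem_annihilatorIdeal hα hα_inj hS hr l
    rw [Submodule.IsPrincipal.mem_iff_generator_dvd] at hmem
    have hlt : (mapCoeff l (q % g)).degree < f.degree := by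
      rw [← degree_map f (algebraMap F K), ← hg]
      rw [degree_eq_natDegree hg0, degree_lt_iff_coeff_zero] at hdeg ⊢
      intro k hk
      rw [coeff_mapCoeff, hdeg k hk, map_zero]
    rw [← coeff_mapCoeff, eq_zero_of_dvd_of_degree_lt hmem hlt, coeff_zero]
  refine ⟨f, hf0, (annihilatingPoly_splits lam α).of_dvd (annihilatingPoly_monic lam α).ne_zero
    hdvd, ?_, hfI⟩
  ext x
  rw [mem_rootSet_of_ne hf0, aeval_def, eval₂_eq_eval_map, ← hg]
  refine ⟨fun hx => mem_range_of_eval_annihilatingPoly_eq_zero lam α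
    (eval_eq_zero_of_dvd_of_eval_eq_zero hdvd hx), ?_⟩
  rintro ⟨i, rfl⟩
  obtain ⟨p, c, hc, hp⟩ := exists_aeval_seqShift_powerSum_eq_zpow hα hα_inj (hlam i)
  have h0 : aeval (seqShift K) (g * p) (powerSum lam α) 0 = 0 := by
    rw [mul_comm, map_mul, Module.End.mul_apply, mem_annihilatorIdeal.1 hfI, map_zero,
      Pi.zero_apply]
  rw [map_mul, Module.End.mul_apply, hp, aeval_seqShift_apply] at h0
  have h1 : c * g.eval (α i) = 0 := by
    rw [← h0, eval_eq_sum, Polynomial.sum_def, Polynomial.sum_def, Finset.mul_sum]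
    refine Finset.sum_congr rfl fun j _ => ?_
    rw [zero_add, zpow_natCast]
    ring
  exact (mul_eq_zero.1 h1).resolve_left hc

/-- The recurrence relation over `F` has nonzero constant term, so it can be run backwards. -/
lemma powerSum_mem_range [CharZero F] {lam : Fin m → K[X]} (hlam : ∀ i, lam i ≠ 0)
    {α : Fin m → K} (hα : ∀ i, α i ≠ 0) (hα_inj : Function.Injective α) {n₀ : ℤ}
    (hS : ∀ n : ℤ, n₀ ≤ n → powerSum lam α n ∈ Set.range (algebraMap F K)) (n : ℤ) :
    powerSum lam α n ∈ Set.range (algebraMap F K) := by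
  obtain ⟨f, hf0, -, hroots, hfI⟩ := exists_annihilator_splits hlam hα hα_inj hS
  have hf : f.coeff 0 ≠ 0 := by
    intro h
    have h0 : (0 : K) ∈ f.rootSet K := by
      rw [mem_rootSet_of_ne hf0, aeval_def, eval₂_at_zero, h, map_zero]
    rw [hroots] at h0
    obtain ⟨i, hi⟩ := h0
    exact hα i hi
  have key : ∀ (t : ℕ) (n : ℤ), n₀ - t ≤ n → powerSum lam α n ∈ (algebraMap F K).fieldRange := by
    intro t
    induction t with
    | zero => exact fun n hn => hS n (by simpa using hn)
    | succ t ih =>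
      intro n hn
      have h0 := congrFun (mem_annihilatorIdeal.1 hfI) n
      rw [aeval_seqShift_apply_of_le (Nat.lt_succ_self _), Finset.sum_range_succ', Pi.zero_apply,
        Nat.cast_zero, add_zero, coeff_map] at h0
      have hf' : algebraMap F K (f.coeff 0) ≠ 0 := by simpa using hf
      rw [(eq_div_iff hf').2 ((mul_comm _ _).trans (eq_neg_of_add_eq_zero_right h0))]
      refine div_mem (neg_mem (sum_mem fun j _ => mul_mem ?_ (ih _ ?_))) ⟨_, rfl⟩
      · rw [coeff_map]
        exact ⟨_, rfl⟩
      · push_cast at hn ⊢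
        omega
  exact key (n₀ - n).toNat n (by omega)

/-- If the `α_i` lie in `F`, an `F`-linear retraction of `K` onto `F` shows that the `λ_i` have
their coefficients in `F`. -/
lemma exists_map_eq_of_powerSum_mem_range [CharZero F] {lam : Fin m → K[X]} {a : Fin m → F}
    (ha : ∀ i, a i ≠ 0) (ha_inj : Function.Injective a)
    (hS : ∀ n : ℤ, powerSum lam (fun i => algebraMap F K (a i)) n ∈ Set.range (algebraMap F K)) :
    ∃ Lam : Fin m → F[X], ∀ i, (Lam i).map (algebraMap F K) = lam i := by
  have : CharZero K := charZero_of_algebra (F := F)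
  obtain ⟨l, hl⟩ := LinearMap.exists_leftInverse_of_injective (Algebra.linearMap F K)
    (LinearMap.ker_eq_bot.2 (algebraMap F K).injective)
  have hl' : ∀ x : F, l (algebraMap F K x) = x := fun x => LinearMap.congr_fun hl x
  refine ⟨fun i => mapCoeff l (lam i), fun i => ?_⟩
  refine congrFun (eq_of_powerSum_eq (α := fun i => algebraMap F K (a i)) (n₀ := 0)
    (lam := fun i => (mapCoeff l (lam i)).map (algebraMap F K)) (mu := lam)
    (fun i => by simpa using ha i) ((algebraMap F K).injective.comp ha_inj) fun n _ => ?_) i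
  rw [← map_powerSum]
  obtain ⟨x, hx⟩ := hS n
  rw [← hx]
  congr 1
  rw [← hl' x, hx, powerSum, powerSum, map_sum]
  refine Finset.sum_congr rfl fun i _ => ?_
  rw [eval_mapCoeff, map_intCast, ← map_zpow₀, mul_comm (eval _ _), ← Algebra.smul_def, map_smul,
    smul_eq_mul, mul_comm]

end Descent

/-! ### Galois action on the roots and on the polynomial factors -/

section Galois

variable {F K : Type*} [Field F] [Field K] [Algebra F K] {m : ℕ}

lemma rootIn_ne_zero {α : Fin m → K} (hα : ∀ i, α i ≠ 0) (i : Fin m) : rootIn F α i ≠ 0 :=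
  fun h => hα i (congrArg Subtype.val h)

lemma rootIn_injective {α : Fin m → K} (hα_inj : Function.Injective α) :
    Function.Injective (rootIn F α) :=
  fun _ _ h => hα_inj (congrArg Subtype.val h)

/-- In a finite Galois extension, an element fixed by all automorphisms fixing a set `S` pointwise
lies in the field generated by `S`. -/
lemma mem_adjoin_of_forall_algEquiv {L : Type*} [Field L] [Algebra F L] [FiniteDimensional F L]
    [IsGalois F L] {S : Set L} {x : L}
    (h : ∀ σ : L ≃ₐ[F] L, (∀ y ∈ S, σ y = y) → σ x = x) : x ∈ IntermediateField.adjoin F S := by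
  rw [← IsGalois.fixedField_fixingSubgroup (IntermediateField.adjoin F S),
    IntermediateField.mem_fixedField_iff]
  intro σ hσ
  rw [IntermediateField.mem_fixingSubgroup_iff] at hσ
  exact h σ fun y hy => hσ y (IntermediateField.subset_adjoin F S hy)

/-- An automorphism of a field containing the `α_i` that sends `α_i` to `α_{π i}` sends `λ_i` to
`λ_{π i}`, as it fixes the values of the sum. -/
lemma map_eq_of_forall_apply_eq [CharZero F] {a : Fin m → F} (ha : ∀ i, a i ≠ 0)
    (ha_inj : Function.Injective a) {Lam : Fin m → F[X]} (σ : F →+* F)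
    (hσ : ∀ n, σ (powerSum Lam a n) = powerSum Lam a n) (π : Equiv.Perm (Fin m))
    (hπ : ∀ i, σ (a i) = a (π i)) (i : Fin m) : (Lam i).map σ = Lam (π i) := by
  have h := eq_of_powerSum_eq (lam := fun j => (Lam (π.symm j)).map σ) (mu := Lam) ha ha_inj
    (n₀ := 0) fun n _ => by
      rw [← hσ n, map_powerSum, powerSum, powerSum, ← Equiv.sum_comp π]
      simp [hπ]
  simpa using congrFun h (π i)

lemma exists_perm_of_algEquiv {α : Fin m → K} (hα_inj : Function.Injective α) {f : F[X]}
    (hf : f ≠ 0) (hroots : f.rootSet K = Set.range α)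
    (σ : rootsField F α ≃ₐ[F] rootsField F α) :
    ∃ π : Equiv.Perm (Fin m), ∀ i, σ (rootIn F α i) = rootIn F α (π i) := by
  have hex : ∀ i, ∃ j, σ (rootIn F α i) = rootIn F α j := by
    intro i
    have hmem : ((σ (rootIn F α i) : rootsField F α) : K) ∈ f.rootSet K := by
      have hi : aeval (rootIn F α i) f = 0 := by
        apply Subtype.val_injective
        have h : α i ∈ f.rootSet K := hroots ▸ Set.mem_range_self i
        rw [mem_rootSet_of_ne hf] at h
        rw [← IntermediateField.aeval_coe]
        exact h
      rw [mem_rootSet_of_ne hf, IntermediateField.aeval_coe, aeval_algHom_apply, hi, map_zero,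
        ZeroMemClass.coe_zero]
    rw [hroots] at hmem
    obtain ⟨j, hj⟩ := hmem
    exact ⟨j, Subtype.ext hj.symm⟩
  choose π hπ using hex
  have hinj : Function.Injective π := fun i j hij =>
    rootIn_injective (F := F) hα_inj (σ.injective (by rw [hπ, hπ, hij]))
  exact ⟨Equiv.ofBijective π (Finite.injective_iff_bijective.1 hinj), hπ⟩

lemma isGalois_rootsField [CharZero F] {α : Fin m → K} {f : F[X]}
    (hsplit : (f.map (algebraMap F K)).Splits) (hroots : f.rootSet K = Set.range α) :
    FiniteDimensional F (rootsField F α) ∧ IsGalois F (rootsField F α) := by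
  have hsf : f.IsSplittingField F (rootsField F α) := by
    rw [rootsField, ← hroots]
    exact IntermediateField.adjoin_rootSet_isSplittingField hsplit
  have hnormal : Normal F (rootsField F α) := Normal.of_isSplittingField f
  exact ⟨IsSplittingField.finiteDimensional _ f, {}⟩

lemma map_mem_of_mem_adjoin {L : IntermediateField F K} {S : Set L} {M : IntermediateField F K}
    (hS : ∀ y ∈ S, (y : K) ∈ M) {x : L} (hx : x ∈ IntermediateField.adjoin F S) : (x : K) ∈ M := by
  have : IntermediateField.adjoin F S ≤ M.comap L.val :=
    IntermediateField.adjoin_le_iff.2 fun y hy => hS y hy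
  exact this hx

end Galois

/-! ### Bounded sums -/

/-- A bounded sequence `S` gives bounded sequences `p(E) S`, for `E` the shift; one of them is a
nonzero multiple of `α_i ^ n`. -/
lemma ringNorm_le_one_of_powerSum_isBigO {C : Type*} [Field C] [CharZero C] (N : RingNorm C)
    (hN : IsPowMul N) {m : ℕ} {lam : Fin m → C[X]} {α : Fin m → C} (hα : ∀ i, α i ≠ 0)
    (hα_inj : Function.Injective α) {i : Fin m} (hi : lam i ≠ 0)
    (h : (fun n : ℤ => N (powerSum lam α n)) =O[atTop] (fun _ => (1 : ℝ))) : N (α i) ≤ 1 := by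
  obtain ⟨B, hB⟩ := h.bound
  obtain ⟨n₁, hn₁⟩ := eventually_atTop.1 hB
  obtain ⟨p, c, hc, hp⟩ := exists_aeval_seqShift_powerSum_eq_zpow hα hα_inj hi
  set D : ℝ := ∑ j ∈ Finset.range (p.natDegree + 1), N (p.coeff j) * B with hD
  have hbound : ∀ n : ℕ, n₁ ≤ n → N (α i ^ n) ≤ N c⁻¹ * D := by
    intro n hn
    have hcn := congrFun hp n
    rw [zpow_natCast, aeval_seqShift_apply_of_le (Nat.lt_succ_self _)] at hcn
    have hle : N (c * α i ^ n) ≤ D := by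
      rw [← hcn]
      refine (Finset.le_sum_of_subadditive N (map_zero N).le (map_add_le_add N) _ _).trans
        (Finset.sum_le_sum fun j _ => ?_)
      refine (map_mul_le_mul N _ _).trans (mul_le_mul_of_nonneg_left ?_ (apply_nonneg N _))
      have := hn₁ (n + j) (by omega)
      rwa [norm_one, mul_one, Real.norm_of_nonneg (apply_nonneg N _)] at this
    calc N (α i ^ n) = N (c⁻¹ * (c * α i ^ n)) := by rw [inv_mul_cancel_left₀ hc]
      _ ≤ N c⁻¹ * N (c * α i ^ n) := map_mul_le_mul N _ _
      _ ≤ N c⁻¹ * D := mul_le_mul_of_nonneg_left hle (apply_nonneg N _)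
  by_contra! hgt
  obtain ⟨t, ht⟩ := pow_unbounded_of_one_lt (N c⁻¹ * D) hgt
  have hmax : N (α i) ^ t ≤ N (α i) ^ (max (max t n₁.toNat) 1) :=
    pow_le_pow_right₀ hgt.le ((le_max_left _ _).trans (le_max_left _ _))
  rw [← hN _ (le_max_right _ _)] at hmax
  exact absurd (ht.trans_le (hmax.trans (hbound _ (by omega)))) (lt_irrefl _)

theorem theorem4p2
    {k : Type*} [Field k] [NumberField k] (v : IsDedekindDomain.HeightOneSpectrum (𝓞 k))
    {C : Type*} [Field C] [Algebra (v.adicCompletion k) C] [IsAlgClosure (v.adicCompletion k) C]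
    (γ : C) (k' : Subfield C)
    (hk' : k' ≤ (IntermediateField.adjoin (v.adicCompletion k) {γ}).toSubfield)
    {K : Type*} [Field K] [Algebra k' K]
    {m : ℕ} (lam : Fin m → K[X]) (hlam : ∀ i, lam i ≠ 0)
    (α : Fin m → K) (hα : ∀ i, α i ≠ 0) (hα_inj : Function.Injective α)
    (n₀ : ℤ) (hS : ∀ n : ℤ, n₀ ≤ n → powerSum lam α n ∈ Set.range (algebraMap k' K)) :
    -- `s n` is the element of `k'` equal to `S_n`, for every integer `n`
    (∃ s : ℤ → k', (∀ n : ℤ, algebraMap k' K (s n) = powerSum lam α n) ∧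
      -- (i), the bound on the absolute values, for every embedding over `k'`
      ((fun n : ℤ => absV v (s n : C)) =O[atTop] (fun _ => (1 : ℝ)) →
        ∀ (φ : rootsField k' α →ₐ[k'] C) (i : Fin m), absV v (φ (rootIn k' α i)) ≤ 1)) ∧
    -- (i), algebraicity
    (∃ f : k'[X], f ≠ 0 ∧ (f.map (algebraMap k' K)).Splits ∧ f.rootSet K = Set.range α) ∧
    Nonempty (rootsField k' α →ₐ[k'] C) ∧
    -- (ii)
    (∀ i, coeffField k' (lam i) ≤ k'⟮α i⟯) ∧
    -- (iii)
    (∃ Lam : Fin m → (rootsField k' α)[X],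
      (∀ i, (Lam i).map (algebraMap (rootsField k' α) K) = lam i) ∧
      ∀ (σ : rootsField k' α ≃ₐ[k'] rootsField k' α) (π : Equiv.Perm (Fin m)),
        (∀ i, σ (rootIn k' α i) = rootIn k' α (π i)) →
        ∀ i, (Lam i).map (σ : rootsField k' α →+* rootsField k' α) = Lam (π i)) ∧
    -- (iv)
    (Function.Injective lam → ∀ i, k'⟮α i⟯ = coeffField k' (lam i)) := by
  have hkv : CharZero (v.adicCompletion k) := charZero_of_algebra (F := k)
  have hC : CharZero C := charZero_of_algebra (F := v.adicCompletion k)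
  have hk'0 : CharZero k' := (RingHom.charZero_iff k'.subtype.injective).2 hC
  have hK : CharZero K := charZero_of_algebra (F := k')
  have hrange := powerSum_mem_range hlam hα hα_inj hS
  choose s hs using hrange
  obtain ⟨f, hf0, hsplit, hroots, -⟩ := exists_annihilator_splits hlam hα hα_inj hS
  obtain ⟨hfin, hgal⟩ := isGalois_rootsField hsplit hroots
  have hL : CharZero (rootsField k' α) := charZero_of_algebra (F := k')
  have ha : ∀ i, rootIn k' α i ≠ 0 := rootIn_ne_zero hα
  have ha_inj : Function.Injective (rootIn k' α) := rootIn_injective hα_inj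
  obtain ⟨Lam, hLam⟩ := exists_map_eq_of_powerSum_mem_range (F := rootsField k' α) (lam := lam)
    ha ha_inj fun n => ⟨algebraMap k' _ (s n), hs n⟩
  have hLam0 : ∀ i, Lam i ≠ 0 := fun i h => hlam i (by rw [← hLam i, h, Polynomial.map_zero])
  -- The relation `S_n = ∑ i, λ_i(n) * α_i ^ n` takes place in `k'(α_1, …, α_m)`.
  have hsL : ∀ n, powerSum Lam (rootIn k' α) n = algebraMap k' (rootsField k' α) (s n) := by
    intro n
    apply (algebraMap (rootsField k' α) K).injective
    rw [map_powerSum, ← IsScalarTower.algebraMap_apply, hs]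
    simp only [hLam]
    rfl
  have hconj : ∀ (σ : rootsField k' α ≃ₐ[k'] rootsField k' α) (π : Equiv.Perm (Fin m)),
      (∀ i, σ (rootIn k' α i) = rootIn k' α (π i)) →
        ∀ i, (Lam i).map (σ : rootsField k' α →+* rootsField k' α) = Lam (π i) :=
    fun σ π hπ i => map_eq_of_forall_apply_eq ha ha_inj _
      (fun n => by rw [hsL]; exact σ.commutes _) π hπ i
  have hcoeff : ∀ i j, (((Lam i).coeff j : rootsField k' α) : K) = (lam i).coeff j := by
    intro i j
    rw [← hLam i, coeff_map]
    rfl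
  have hle : ∀ i, coeffField k' (lam i) ≤ k'⟮α i⟯ := by
    intro i
    refine IntermediateField.adjoin_le_iff.2 ?_
    rintro _ ⟨j, rfl⟩
    rw [← hcoeff]
    refine map_mem_of_mem_adjoin (S := {rootIn k' α i}) ?_ (mem_adjoin_of_forall_algEquiv ?_)
    · rintro _ rfl
      exact IntermediateField.mem_adjoin_simple_self k' (α i)
    · intro σ hσ
      obtain ⟨π, hπ⟩ := exists_perm_of_algEquiv hα_inj hf0 hroots σ
      have hi : π i = i := ha_inj ((hπ i).symm.trans (hσ _ rfl))
      have := hconj σ π hπ i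
      rw [hi] at this
      exact (coeff_map _ j).symm.trans (congrArg (coeff · j) this)
  refine ⟨⟨s, hs, ?_⟩, ⟨f, hf0, hsplit, hroots⟩, ?_, hle, ⟨Lam, hLam, hconj⟩, ?_⟩
  · intro hbdd φ i
    have : Algebra.IsAlgebraic (v.adicCompletion k) C := IsAlgClosure.isAlgebraic
    refine ringNorm_le_one_of_powerSum_isBigO
      (spectralAlgNorm (v.adicCompletion k) C).toRingNorm isPowMul_spectralNorm
      (lam := fun i => (Lam i).map (φ : rootsField k' α →+* C))
      (α := fun i => φ (rootIn k' α i)) (fun i => by simpa using ha i)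
      (φ.injective.comp ha_inj) (i := i)
      ((Polynomial.map_ne_zero_iff (φ : rootsField k' α →+* C).injective).2 (hLam0 i)) ?_
    refine hbdd.congr_left fun n => ?_
    have hn : (s n : C) = powerSum (fun i => (Lam i).map (φ : rootsField k' α →+* C))
        (fun i => φ (rootIn k' α i)) n :=
      (φ.commutes (s n)).symm.trans
        ((congrArg φ (hsL n)).symm.trans (map_powerSum (φ : rootsField k' α →+* C) Lam _ n))
    rw [hn]
    rfl
  · have : IsAlgClosed C := IsAlgClosure.isAlgClosed (v.adicCompletion k)
    exact ⟨IsAlgClosed.lift⟩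
  · intro hinj i
    refine le_antisymm (IntermediateField.adjoin_simple_le_iff.2 ?_) (hle i)
    change ((rootIn k' α i : rootsField k' α) : K) ∈ _
    refine map_mem_of_mem_adjoin (S := Set.range (Lam i).coeff) ?_
      (mem_adjoin_of_forall_algEquiv ?_)
    · rintro _ ⟨j, rfl⟩
      rw [hcoeff]
      exact IntermediateField.subset_adjoin k' _ ⟨j, rfl⟩
    · intro σ hσ
      obtain ⟨π, hπ⟩ := exists_perm_of_algEquiv hα_inj hf0 hroots σ
      have hfix : Lam (π i) = Lam i := by
        rw [← hconj σ π hπ i]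
        ext1 j
        rw [coeff_map]
        exact hσ _ ⟨j, rfl⟩
      have hi : π i = i := hinj (by rw [← hLam, ← hLam, hfix])
      rw [hπ, hi]
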